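/- Let $\mathbf{D}$ be the open unit disk of $\mathbb{C}$. Let $\mathcal{B}$ (the Bloch space) be the space of analytic functions $f:\mathbf{D}\to\mathbb{C}$ with $\sup_{z\in\mathbf{D}}(1-|z|^2)|f'(z)|<\infty$, and let $\mathcal{B}_0$ (the little Bloch space) be the subspace of those $f\in\mathcal{B}$ with $\lim_{|z|\to 1}(1-|z|^2)|f'(z)|=0$. Let $\ell_\infty$ be the space of bounded complex sequences and $c_0$ the space of complex sequences converging to $0$. Let $(z_n)_{n\in\mathbb{N}}$ be a sequence of points of $\mathbf{D}$. Then the following assertions are equivalent: 1. $(z_n)$ is $c_0$-interpolating for $\mathcal{B}$: for every $(a_n)\in c_0$ there is $f\in\mathcal{B}$ with $(1-|z_n|^2)f'(z_n)=a_n$ for all $n\in\mathbb{N}$; 2. $(z_n)$ is $c_0$-interpolating for $\mathcal{B}_0$: for every $(a_n)\in c_0$ there is $f\in\mathcal{B}_0$ with $(1-|z_n|^2)f'(z_n)=a_n$ for all $n\in\mathbb{N}$; 3. $(z_n)$ is interpolating for $\mathcal{B}$: for every $(a_n)\in\ell_\infty$ there is $f\in\mathcal{B}$ with $(1-|z_n|^2)f'(z_n)=a_n$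 for all $n\in\mathbb{N}$; 4. $(z_n)$ interpolates the idempotents of $\ell_\infty$ by functions of $\mathcal{B}$: for every $(a_n)\in\ell_\infty$ with $a_n^2=a_n$ for all $n$ (that is, $a_n\in\{0,1\}$ for all $n$), there is $f\in\mathcal{B}$ with $(1-|z_n|^2)f'(z_n)=a_n$ for all $n\in\mathbb{N}$. -/

import Mathlib

open Filter Topology Metric
open scoped ENNReal

/-- The Bloch space: functions analytic on the open unit disk with
`sup_{|z| < 1} (1 - |z|²) |f'(z)| < ∞`. Values of `f` outside the disk are irrelevant. -/
def blochSpace : Set (ℂ → ℂ) :=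
  {f | DifferentiableOn ℂ f (ball 0 1) ∧
    BddAbove ((fun z : ℂ => (1 - ‖z‖ ^ 2) * ‖deriv f z‖) '' ball 0 1)}

/-- The little Bloch space: Bloch functions with `(1 - |z|²) |f'(z)| → 0` as `|z| → 1`
inside the disk. -/
def littleBlochSpace : Set (ℂ → ℂ) :=
  {f | f ∈ blochSpace ∧
    Tendsto (fun z : ℂ => (1 - ‖z‖ ^ 2) * ‖deriv f z‖) (comap norm (𝓝[<] (1 : ℝ))) (𝓝 0)}

/-- The bounded complex sequences. -/
def ellInfty : Set (ℕ → ℂ) := {a | Memℓp a ∞}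

/-- The complex sequences that converge to zero. -/
def cZero : Set (ℕ → ℂ) := {a | Tendsto a atTop (𝓝 0)}

/-- The idempotents of `ℓ∞`. -/
def ellInftyIdempotents : Set (ℕ → ℂ) := {a | a ∈ ellInfty ∧ IsIdempotentElem a}

/-- Every target sequence in `A` is of the form `((1 - |z_n|²) f'(z_n))` for some `f ∈ X`. -/
def Interpolates (X : Set (ℂ → ℂ)) (A : Set (ℕ → ℂ)) (z : ℕ → ℂ) : Prop :=
  ∀ a ∈ A, ∃ f ∈ X, ∀ n, (((1 - ‖z n‖ ^ 2 : ℝ) : ℂ)) * deriv f (z n) = a n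

/-! Only `g = f'` matters, since holomorphic functions on the disk have primitives. By normality,
`traceSet z C` is closed under pointwise convergence (`isClosed_traceSet`). Hence Baire's theorem,
in the Banach space of null sequences or in the Cantor space of idempotents, turns solvability into
solvability with one constant. From null sequences, truncation then reaches the unit ball of ℓ∞;
from idempotents, sign patterns approximate that ball up to a factor below 1, and the error is
iterated away.

For the little Bloch space, interpolation forces `|z n| → 1`. A dilation `g (r * w)` vanishes at the
boundary but matches `g` at only finitely many nodes; averaging many dilations makes the mismatch
uniformly small (`exists_vanishing_approx`), and a geometric series of corrections gives exact
values. -/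

/-- Holomorphic functions on the open unit disk with `(1 - |z|²) |g(z)| ≤ C`. -/
def HasBlochGrowth (C : ℝ) (g : ℂ → ℂ) : Prop :=
  DifferentiableOn ℂ g (ball 0 1) ∧ ∀ z ∈ ball (0 : ℂ) 1, (1 - ‖z‖ ^ 2) * ‖g z‖ ≤ C

/-- The weighted values of `g` along the sequence `z`. -/
noncomputable def weightedTrace (z : ℕ → ℂ) (g : ℂ → ℂ) (n : ℕ) : ℂ := ((1 - ‖z n‖ ^ 2 : ℝ) : ℂ) * g (z n)

/-- The weighted traces of functions with growth constant `C`. -/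
def traceSet (z : ℕ → ℂ) (C : ℝ) : Set (ℕ → ℂ) :=
  {a | ∃ g, HasBlochGrowth C g ∧ weightedTrace z g = a}

theorem one_sub_norm_sq_pos {w : ℂ} (hw : w ∈ ball (0 : ℂ) 1) : 0 < 1 - ‖w‖ ^ 2 := by
  have h : ‖w‖ < 1 := by simpa using hw
  nlinarith [norm_nonneg w]

/-! ### Bloch growth: algebra and normal families -/

namespace HasBlochGrowth

variable {C D : ℝ} {g h : ℂ → ℂ}

theorem nonneg (hg : HasBlochGrowth C g) : 0 ≤ C := by
  have := hg.2 0 (by simp)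
  have h2 := norm_nonneg (g 0)
  simp at this
  linarith

theorem mono (hg : HasBlochGrowth C g) (hCD : C ≤ D) : HasBlochGrowth D g :=
  ⟨hg.1, fun z hz => (hg.2 z hz).trans hCD⟩

theorem add (hg : HasBlochGrowth C g) (hh : HasBlochGrowth D h) :
    HasBlochGrowth (C + D) (fun w => g w + h w) := by
  refine ⟨hg.1.add hh.1, fun w hw => ?_⟩
  have h0 := one_sub_norm_sq_pos hw
  have := mul_le_mul_of_nonneg_left (norm_add_le (g w) (h w)) h0.le
  linarith [hg.2 w hw, hh.2 w hw]

theorem smul (c : ℂ) (hg : HasBlochGrowth C g) :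
    HasBlochGrowth (‖c‖ * C) (fun w => c * g w) := by
  refine ⟨hg.1.const_mul c, fun w hw => ?_⟩
  have := mul_le_mul_of_nonneg_left (hg.2 w hw) (norm_nonneg c)
  rw [norm_mul]
  linarith

theorem norm_le_of_norm_le (hg : HasBlochGrowth C g) {ρ : ℝ} (hρ : ρ < 1) {w : ℂ}
    (hw : ‖w‖ ≤ ρ) : ‖g w‖ ≤ C / (1 - ρ ^ 2) := by
  have h0 := norm_nonneg w
  have h1 : 0 < 1 - ρ ^ 2 := by nlinarith
  rw [le_div_iff₀ h1]
  refine le_trans ?_ (hg.2 w (by simpa using hw.trans_lt hρ))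
  rw [mul_comm]
  gcongr

theorem norm_weightedTrace_le (hg : HasBlochGrowth C g) {z : ℕ → ℂ} {n : ℕ}
    (hz : z n ∈ ball (0 : ℂ) 1) : ‖weightedTrace z g n‖ ≤ C := by
  have h0 := one_sub_norm_sq_pos hz
  rw [weightedTrace, norm_mul, Complex.norm_real, Real.norm_of_nonneg h0.le]
  exact hg.2 _ hz

theorem comp_mul (hg : HasBlochGrowth C g) {r : ℝ} (h0 : 0 < r) (h1 : r < 1) :
    HasBlochGrowth C (fun w => g (r * w)) := by
  have hr (w : ℂ) : ‖(r : ℂ) * w‖ = r * ‖w‖ := by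
    rw [norm_mul, Complex.norm_real, Real.norm_of_nonneg h0.le]
  have hm : ∀ w ∈ ball (0 : ℂ) 1, (r : ℂ) * w ∈ ball (0 : ℂ) 1 := by
    intro w hw
    rw [mem_ball_zero_iff] at hw ⊢
    rw [hr]
    nlinarith [norm_nonneg w]
  refine ⟨hg.1.comp (by fun_prop) hm, fun w hw => le_trans ?_ (hg.2 _ (hm w hw))⟩
  gcongr
  rw [hr]
  nlinarith [norm_nonneg w]

/-- A family of functions of uniform Bloch growth is locally equicontinuous. -/
theorem eventually_dist_le (C : ℝ) {x : ℂ} (hx : x ∈ ball (0 : ℂ) 1) {ε : ℝ} (hε : 0 < ε) :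
    ∀ᶠ y in 𝓝 x, ∀ g, HasBlochGrowth C g → dist (g y) (g x) ≤ ε := by
  have hx' : ‖x‖ < 1 := by simpa using hx
  set ρ := (1 + ‖x‖) / 2 with hρ
  set s := (1 - ‖x‖) / 2 with hs
  have hs0 : 0 < s := by linarith
  have hρ1 : ρ < 1 := by linarith
  have hsub : ∀ y ∈ ball x s, ‖y‖ ≤ ρ := by
    intro y hy
    have h1 : ‖y - x‖ < s := by simpa [dist_eq_norm] using hy
    have h2 := norm_add_le (y - x) x
    rw [sub_add_cancel] at h2
    linarith
  set B := C / (1 - ρ ^ 2) with hB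
  have hlim : Tendsto (fun y => 2 * B / s * dist y x) (𝓝 x) (𝓝 0) := by
    have : Continuous fun y => 2 * B / s * dist y x := by fun_prop
    simpa using this.tendsto x
  filter_upwards [ball_mem_nhds x hs0, hlim.eventually (ge_mem_nhds hε)] with y hy hy2 g hg
  refine le_trans ?_ hy2
  -- Schwarz lemma: `g` maps `ball x s` into the closed disk of radius `2 * B` about `g x`.
  refine Complex.dist_le_div_mul_dist_of_mapsTo_ball (c := x) (R₁ := s) (hg.1.mono ?_) ?_ hy
  · intro w hw
    simpa using (hsub w hw).trans_lt hρ1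
  · intro w hw
    have h1 := hg.norm_le_of_norm_le hρ1 (hsub w hw)
    have h2 := hg.norm_le_of_norm_le hρ1 (hsub x (mem_ball_self hs0))
    rw [mem_closedBall, dist_eq_norm]
    linarith [norm_sub_le (g w) (g x)]

/-- Functions of uniform Bloch growth form a normal family. -/
theorem exists_tendsto (U : Ultrafilter ℕ) {F : ℕ → ℂ → ℂ} (hF : ∀ k, HasBlochGrowth C (F k)) :
    ∃ g, HasBlochGrowth C g ∧
      ∀ w ∈ ball (0 : ℂ) 1, Tendsto (fun k => F k w) U (𝓝 (g w)) := by
  have hlim : ∀ w : ℂ, ∃ y : ℂ, w ∈ ball (0 : ℂ) 1 → Tendsto (fun k => F k w) U (𝓝 y) := by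
    intro w
    by_cases hw : w ∈ ball (0 : ℂ) 1
    · have hK := isCompact_closedBall (0 : ℂ) (C / (1 - ‖w‖ ^ 2))
      obtain ⟨y, -, hy⟩ := hK.ultrafilter_le_nhds (U.map fun k => F k w) (by
        rw [le_principal_iff]
        change ∀ᶠ k in (U : Filter ℕ), F k w ∈ closedBall (0 : ℂ) _
        refine Eventually.of_forall fun k => ?_
        simpa using (hF k).norm_le_of_norm_le (by simpa using hw) le_rfl)
      exact ⟨y, fun _ => hy⟩
    · exact ⟨0, fun h => absurd h hw⟩
  choose g hg using hlim
  refine ⟨g, ⟨?_, fun w hw => ?_⟩, hg⟩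
  · refine TendstoLocallyUniformlyOn.differentiableOn (F := F) (φ := (U : Filter ℕ)) ?_
      (Eventually.of_forall fun k => (hF k).1) isOpen_ball
    rw [Metric.tendstoLocallyUniformlyOn_iff]
    intro ε hε x hx
    have h1 := eventually_dist_le C hx (show 0 < ε / 4 by linarith)
    have h2 := isOpen_ball.mem_nhds hx
    refine ⟨_, mem_nhdsWithin_of_mem_nhds (inter_mem h1 h2), ?_⟩
    filter_upwards [(hg x hx).eventually (ball_mem_nhds _ (show 0 < ε / 4 by linarith))]
      with k hk y hy
    have h3 : dist (g y) (g x) ≤ ε / 4 :=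
      le_of_tendsto ((hg y hy.2).dist (hg x hx)) (Eventually.of_forall fun k => hy.1 _ (hF k))
    have h4 := hy.1 _ (hF k)
    have h5 : dist (F k x) (g x) < ε / 4 := hk
    have h6 := dist_triangle4 (g y) (g x) (F k x) (F k y)
    rw [dist_comm (g x), dist_comm (F k x) (F k y)] at h6
    linarith
  · exact le_of_tendsto (((hg w hw).norm).const_mul _) (Eventually.of_forall fun k => (hF k).2 w hw)

end HasBlochGrowth

/-! ### Trace sets -/

theorem weightedTrace_add (z : ℕ → ℂ) (g h : ℂ → ℂ) :
    weightedTrace z (fun w => g w + h w) = weightedTrace z g + weightedTrace z h := by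
  ext n; simp [weightedTrace, mul_add]

theorem weightedTrace_smul (z : ℕ → ℂ) (c : ℂ) (g : ℂ → ℂ) :
    weightedTrace z (fun w => c * g w) = c • weightedTrace z g := by
  ext n; simp [weightedTrace]; ring

section traceSet

variable {z : ℕ → ℂ} {C D : ℝ} {a b : ℕ → ℂ}

theorem traceSet_mono (hCD : C ≤ D) : traceSet z C ⊆ traceSet z D := by
  rintro a ⟨g, hg, rfl⟩
  exact ⟨g, hg.mono hCD, rfl⟩

theorem add_mem_traceSet (ha : a ∈ traceSet z C) (hb : b ∈ traceSet z D) :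
    a + b ∈ traceSet z (C + D) := by
  obtain ⟨g, hg, rfl⟩ := ha
  obtain ⟨h, hh, rfl⟩ := hb
  exact ⟨_, hg.add hh, weightedTrace_add z g h⟩

theorem smul_mem_traceSet (c : ℂ) (ha : a ∈ traceSet z C) : c • a ∈ traceSet z (‖c‖ * C) := by
  obtain ⟨g, hg, rfl⟩ := ha
  exact ⟨_, hg.smul c, weightedTrace_smul z c g⟩

theorem sub_mem_traceSet (ha : a ∈ traceSet z C) (hb : b ∈ traceSet z D) :
    a - b ∈ traceSet z (C + D) := by
  have := add_mem_traceSet ha (smul_mem_traceSet (-1) hb)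
  simpa [sub_eq_add_neg] using this

theorem zero_mem_traceSet : (0 : ℕ → ℂ) ∈ traceSet z 0 :=
  ⟨fun _ => 0, ⟨by fun_prop, by simp⟩, by ext n; simp [weightedTrace]⟩

theorem sum_mem_traceSet {ι : Type*} (s : Finset ι) {a : ι → ℕ → ℂ} {C : ι → ℝ}
    (ha : ∀ i ∈ s, a i ∈ traceSet z (C i)) : ∑ i ∈ s, a i ∈ traceSet z (∑ i ∈ s, C i) := by
  classical
  induction s using Finset.induction_on with
  | empty => simpa using zero_mem_traceSet
  | insert i s hi ih =>
    rw [Finset.sum_insert hi, Finset.sum_insert hi]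
    exact add_mem_traceSet (ha i (by simp)) (ih fun j hj => ha j (by simp [hj]))

theorem isClosed_traceSet (hz : ∀ n, z n ∈ ball (0 : ℂ) 1) (C : ℝ) :
    IsClosed (traceSet z C) := by
  refine IsSeqClosed.isClosed fun x a hx hxa => ?_
  choose F hF hFx using hx
  obtain ⟨g, hg, hlim⟩ := HasBlochGrowth.exists_tendsto (hyperfilter ℕ) hF
  refine ⟨g, hg, funext fun n => ?_⟩
  have h1 : Tendsto (fun k => x k n) (hyperfilter ℕ : Filter ℕ) (𝓝 (a n)) :=
    (tendsto_pi_nhds.1 hxa n).mono_left (Nat.hyperfilter_le_atTop)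
  have h2 : Tendsto (fun k => x k n) (hyperfilter ℕ : Filter ℕ) (𝓝 (weightedTrace z g n)) := by
    simp only [← hFx, weightedTrace]
    exact (hlim _ (hz n)).const_mul _
  exact tendsto_nhds_unique h2 h1

end traceSet

theorem exists_hasBlochGrowth_deriv {f : ℂ → ℂ} (hf : f ∈ blochSpace) :
    ∃ C, HasBlochGrowth C (deriv f) := by
  obtain ⟨h1, C, hC⟩ := hf
  exact ⟨C, h1.deriv isOpen_ball, fun w hw => hC ⟨w, hw, rfl⟩⟩

theorem HasBlochGrowth.exists_primitive {C : ℝ} {g : ℂ → ℂ} (hg : HasBlochGrowth C g) :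
    ∃ f ∈ blochSpace, ∀ w ∈ ball (0 : ℂ) 1, deriv f w = g w := by
  obtain ⟨f, hf⟩ := hg.1.isExactOn_ball
  refine ⟨f, ⟨fun w hw => (hf w hw).differentiableAt.differentiableWithinAt, C, ?_⟩,
    fun w hw => (hf w hw).deriv⟩
  rintro _ ⟨w, hw, rfl⟩
  simpa only [(hf w hw).deriv] using hg.2 w hw

theorem interpolates_blochSpace_iff {z : ℕ → ℂ} (hz : ∀ n, z n ∈ ball (0 : ℂ) 1)
    (A : Set (ℕ → ℂ)) :
    Interpolates blochSpace A z ↔ ∀ a ∈ A, ∃ C, a ∈ traceSet z C := by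
  refine forall₂_congr fun a _ => ⟨?_, ?_⟩
  · rintro ⟨f, hf, hfa⟩
    obtain ⟨C, hC⟩ := exists_hasBlochGrowth_deriv hf
    exact ⟨C, _, hC, funext hfa⟩
  · rintro ⟨C, g, hg, rfl⟩
    obtain ⟨f, hf, hfg⟩ := hg.exists_primitive
    exact ⟨f, hf, fun n => by rw [hfg _ (hz n), weightedTrace]⟩

/-! ### Uniform constants from Baire category -/

section uniform

variable {z : ℕ → ℂ}

open scoped ZeroAtInfty in
theorem exists_forall_cZero_mem_traceSet (hz : ∀ n, z n ∈ ball (0 : ℂ) 1)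
    (h : ∀ a ∈ cZero, ∃ C, a ∈ traceSet z C) :
    ∃ C, ∀ a ∈ cZero, (∀ n, ‖a n‖ ≤ 1) → a ∈ traceSet z C := by
  have hcont : Continuous fun x : C₀(ℕ, ℂ) => (x : ℕ → ℂ) :=
    BoundedContinuousFunction.continuous_coe.comp
      (ZeroAtInftyContinuousMap.isometry_toBCF (α := ℕ) (β := ℂ)).continuous
  have hmem (x : C₀(ℕ, ℂ)) : (x : ℕ → ℂ) ∈ cZero := by
    have := x.zero_at_infty'
    rwa [cocompact_eq_cofinite, Nat.cofinite_eq_atTop] at this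
  obtain ⟨k, x, hx⟩ := nonempty_interior_of_iUnion_of_closed
    (f := fun k : ℕ => (fun x : C₀(ℕ, ℂ) => (x : ℕ → ℂ)) ⁻¹' traceSet z k)
    (fun k => (isClosed_traceSet hz k).preimage hcont) (by
      refine Set.eq_univ_of_forall fun x => Set.mem_iUnion.2 ?_
      obtain ⟨C, hC⟩ := h _ (hmem x)
      obtain ⟨k, hk⟩ := exists_nat_ge C
      exact ⟨k, traceSet_mono hk hC⟩)
  obtain ⟨r, hr, hball⟩ := Metric.mem_nhds_iff.1 (mem_interior_iff_mem_nhds.1 hx)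
  refine ⟨‖((r / 2 : ℝ) : ℂ)⁻¹‖ * (k + k), fun a ha ha1 => ?_⟩
  let y : C₀(ℕ, ℂ) := ⟨⟨a, continuous_of_discreteTopology⟩, by
    rw [cocompact_eq_cofinite, Nat.cofinite_eq_atTop]; exact ha⟩
  have hy : ‖y‖ ≤ 1 := by
    rw [← ZeroAtInftyContinuousMap.norm_toBCF_eq_norm]
    exact (BoundedContinuousFunction.norm_le zero_le_one).2 ha1
  -- Subtracting the centre `x` and rescaling recovers `y`, which explains the constant.
  have h1 : x + ((r / 2 : ℝ) : ℂ) • y ∈ ball x r := by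
    rw [mem_ball_iff_norm, add_sub_cancel_left, norm_smul, Complex.norm_real,
      Real.norm_of_nonneg (by linarith)]
    nlinarith
  have h2 := sub_mem_traceSet (hball h1) (hball (mem_ball_self hr))
  have h3 := smul_mem_traceSet (((r / 2 : ℝ) : ℂ)⁻¹) h2
  convert h3 using 1
  have hr' : ((r / 2 : ℝ) : ℂ) ≠ 0 := by
    rw [Complex.ofReal_ne_zero]; linarith
  ext n
  simp only [ZeroAtInftyContinuousMap.coe_add, ZeroAtInftyContinuousMap.coe_smul,
    add_sub_cancel_left]
  rw [inv_smul_smul₀ hr']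
  rfl

/-- Truncations are null sequences converging pointwise, so closedness keeps the same `C`. -/
theorem forall_mem_traceSet_of_cZero (hz : ∀ n, z n ∈ ball (0 : ℂ) 1) {C : ℝ}
    (h : ∀ a ∈ cZero, (∀ n, ‖a n‖ ≤ 1) → a ∈ traceSet z C) (a : ℕ → ℂ) (ha : ∀ n, ‖a n‖ ≤ 1) :
    a ∈ traceSet z C := by
  have hlim : Tendsto (fun N n => if n < N then a n else 0) atTop (𝓝 a) := by
    refine tendsto_pi_nhds.2 fun n => tendsto_const_nhds.congr' ?_
    filter_upwards [eventually_gt_atTop n] with N hN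
    simp [hN]
  refine (isClosed_traceSet hz C).mem_of_tendsto hlim (Eventually.of_forall fun N => h _ ?_ ?_)
  · refine tendsto_const_nhds.congr' ?_
    filter_upwards [eventually_ge_atTop N] with n hn
    simp [hn.not_gt]
  · intro n
    split_ifs
    · exact ha n
    · simp

/-- The idempotent sequence attached to a sequence of truth values. -/
def boolSeq (b : ℕ → Bool) (n : ℕ) : ℂ := if b n then 1 else 0

theorem boolSeq_mem (b : ℕ → Bool) : boolSeq b ∈ ellInftyIdempotents := by
  refine ⟨memℓp_infty ⟨1, ?_⟩, ?_⟩
  · rintro _ ⟨n, rfl⟩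
    simp only [boolSeq]
    split_ifs <;> simp
  · ext n
    simp [boolSeq]

theorem exists_forall_boolSeq_mem_traceSet (hz : ∀ n, z n ∈ ball (0 : ℂ) 1)
    (h : ∀ a ∈ ellInftyIdempotents, ∃ C, a ∈ traceSet z C) :
    ∃ C, ∀ b, boolSeq b ∈ traceSet z C := by
  have hcont : Continuous boolSeq := by
    refine continuous_pi fun n => ?_
    exact (continuous_of_discreteTopology (f := fun t : Bool => if t then (1 : ℂ) else 0)).comp
      (continuous_apply n)
  obtain ⟨k, x, hx⟩ := nonempty_interior_of_iUnion_of_closed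
    (f := fun k : ℕ => boolSeq ⁻¹' traceSet z k)
    (fun k => (isClosed_traceSet hz k).preimage hcont) (by
      refine Set.eq_univ_of_forall fun x => Set.mem_iUnion.2 ?_
      obtain ⟨C, hC⟩ := h _ (boolSeq_mem x)
      obtain ⟨k, hk⟩ := exists_nat_ge C
      exact ⟨k, traceSet_mono hk hC⟩)
  -- The interior contains a cylinder: only the coordinates in the finite set `I` are constrained.
  obtain ⟨I, u, hu, hsub⟩ := isOpen_pi_iff.1 isOpen_interior x hx
  have key (b : ℕ → Bool) (hb : ∀ n ∈ I, b n = x n) : boolSeq b ∈ traceSet z k := by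
    refine interior_subset (s := boolSeq ⁻¹' traceSet z k) (hsub fun n hn => ?_)
    rw [hb n hn]
    exact (hu n hn).2
  choose D hD using fun n => h _ (boolSeq_mem fun m => decide (m = n))
  refine ⟨k + k + ∑ n ∈ I, |D n|, fun b => ?_⟩
  -- `h1` minus `h2` is `b` off `I` and `0` on `I`; unit vectors supply the values on `I`.
  have h1 := key (fun n => if n ∈ I then x n else b n) fun n hn => by simp [hn]
  have h2 := key (fun n => if n ∈ I then x n else false) fun n hn => by simp [hn]
  have h3 := sum_mem_traceSet I (a := fun n => boolSeq b n • boolSeq fun m => decide (m = n))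
    (C := fun n => |D n|) (z := z) fun n _ => by
      by_cases hb : b n
      · simpa [boolSeq, hb] using traceSet_mono (le_abs_self _) (hD n)
      · simpa [boolSeq, hb] using traceSet_mono (abs_nonneg (D n)) zero_mem_traceSet
  convert add_mem_traceSet (sub_mem_traceSet h1 h2) h3 using 1
  ext n
  simp only [boolSeq, Pi.add_apply, Pi.sub_apply, Finset.sum_apply, Pi.smul_apply, smul_eq_mul,
    decide_eq_true_eq, mul_ite, mul_one, mul_zero]
  rw [Finset.sum_ite_eq]
  by_cases hn : n ∈ I <;> simp [hn]

/-- Approximate interpolation with a contraction factor gives exact interpolation. -/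
theorem forall_mem_traceSet_of_approx (hz : ∀ n, z n ∈ ball (0 : ℂ) 1) {C q : ℝ} (hq0 : 0 < q)
    (hq1 : q < 1)
    (h : ∀ a : ℕ → ℂ, (∀ n, ‖a n‖ ≤ 1) → ∃ b ∈ traceSet z C, ∀ n, ‖a n - b n‖ ≤ q)
    (a : ℕ → ℂ) (ha : ∀ n, ‖a n‖ ≤ 1) : a ∈ traceSet z (C * (1 - q)⁻¹) := by
  have hC : 0 ≤ C := by
    obtain ⟨b, ⟨g, hg, -⟩, -⟩ := h a ha
    exact hg.nonneg
  -- The residual, at most `q ^ k`, is rescaled to norm at most 1 and approximated again.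
  have step (k : ℕ) : ∃ b ∈ traceSet z (C * ∑ i ∈ Finset.range k, q ^ i),
      ∀ n, ‖a n - b n‖ ≤ q ^ k := by
    induction k with
    | zero => exact ⟨0, by simpa using zero_mem_traceSet, by simpa using ha⟩
    | succ k ih =>
      obtain ⟨b, hb, hab⟩ := ih
      have hqk : 0 < q ^ k := pow_pos hq0 k
      have hqn : ‖((q ^ k : ℝ) : ℂ)‖ = q ^ k := by
        rw [Complex.norm_real, Real.norm_of_nonneg hqk.le]
      have hqne : ((q ^ k : ℝ) : ℂ) ≠ 0 := by
        rw [Complex.ofReal_ne_zero]; exact hqk.ne'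
      obtain ⟨c, hc, hac⟩ := h (fun n => ((q ^ k : ℝ) : ℂ)⁻¹ * (a n - b n)) fun n => by
        rw [norm_mul, norm_inv, hqn]
        exact inv_mul_le_one_of_le₀ (hab n) hqk.le
      refine ⟨b + ((q ^ k : ℝ) : ℂ) • c, ?_, fun n => ?_⟩
      · have := add_mem_traceSet hb (smul_mem_traceSet ((q ^ k : ℝ) : ℂ) hc)
        rw [hqn] at this
        rw [Finset.sum_range_succ, mul_add, mul_comm C (q ^ k)]
        exact this
      · have : a n - (b + ((q ^ k : ℝ) : ℂ) • c) n =
            ((q ^ k : ℝ) : ℂ) * (((q ^ k : ℝ) : ℂ)⁻¹ * (a n - b n) - c n) := by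
          rw [mul_sub, mul_inv_cancel_left₀ hqne, Pi.add_apply, Pi.smul_apply, smul_eq_mul]
          ring
        rw [this, norm_mul, hqn, pow_succ]
        exact mul_le_mul_of_nonneg_left (hac n) hqk.le
  choose b hb hab using step
  refine (isClosed_traceSet hz _).mem_of_tendsto (f := b) (b := atTop) ?_
    (Eventually.of_forall fun k => traceSet_mono ?_ (hb k))
  · refine tendsto_pi_nhds.2 fun n => tendsto_iff_norm_sub_tendsto_zero.2 ?_
    refine squeeze_zero (fun _ => norm_nonneg _) (fun k => ?_)
      (tendsto_pow_atTop_nhds_zero_of_lt_one hq0.le hq1)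
    rw [norm_sub_rev]
    exact hab k n
  · refine mul_le_mul_of_nonneg_left ?_ hC
    rw [← tsum_geometric_of_lt_one hq0.le hq1]
    exact (summable_geometric_of_lt_one hq0.le hq1).sum_le_tsum _ fun i _ => by positivity

theorem exists_forall_mem_traceSet_of_boolSeq (hz : ∀ n, z n ∈ ball (0 : ℂ) 1) {C : ℝ}
    (h : ∀ b, boolSeq b ∈ traceSet z C) :
    ∃ D, ∀ a : ℕ → ℂ, (∀ n, ‖a n‖ ≤ 1) → a ∈ traceSet z D := by
  -- The approximant is `±1/2 ± i/2` by the signs of the real and imaginary parts. Each part errs by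
  -- at most `1/2`, so the error is at most `√2/2 < 3/4`.
  refine ⟨_, forall_mem_traceSet_of_approx hz
    (C := C + ‖(1 / 2 : ℂ)‖ * C + ‖Complex.I‖ * (C + ‖(1 / 2 : ℂ)‖ * C)) (q := 3 / 4) (by norm_num) (by norm_num)
    fun a ha => ?_⟩
  have h1 := h fun n => decide (0 ≤ (a n).re)
  have h2 := h fun n => decide (0 ≤ (a n).im)
  have h3 := smul_mem_traceSet (1 / 2) (h fun _ => true)
  have h4 := smul_mem_traceSet Complex.I (sub_mem_traceSet h2 h3)
  refine ⟨_, add_mem_traceSet (sub_mem_traceSet h1 h3) h4, fun n => ?_⟩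
  have hn := ha n
  rw [← sq_le_sq₀ (norm_nonneg _) zero_le_one, Complex.sq_norm, Complex.normSq_apply] at hn
  rw [← sq_le_sq₀ (norm_nonneg _) (by norm_num), Complex.sq_norm, Complex.normSq_apply]
  have hre : |(a n).re| ≤ 1 := abs_le_one_iff_mul_self_le_one.2
    (by nlinarith [mul_self_nonneg (a n).im])
  have him : |(a n).im| ≤ 1 := abs_le_one_iff_mul_self_le_one.2
    (by nlinarith [mul_self_nonneg (a n).re])
  rw [abs_le] at hre him
  by_cases hr : 0 ≤ (a n).re <;> by_cases hi : 0 ≤ (a n).im <;>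
    · simp [boolSeq, hr, hi]
      nlinarith

theorem mem_traceSet_of_norm_le {C A : ℝ} (hA : 0 < A)
    (h : ∀ a : ℕ → ℂ, (∀ n, ‖a n‖ ≤ 1) → a ∈ traceSet z C) (a : ℕ → ℂ) (ha : ∀ n, ‖a n‖ ≤ A) :
    a ∈ traceSet z (A * C) := by
  have hAn : ‖(A : ℂ)‖ = A := by rw [Complex.norm_real, Real.norm_of_nonneg hA.le]
  have h1 := h (fun n => (A : ℂ)⁻¹ * a n) fun n => by
    rw [norm_mul, norm_inv, hAn]
    exact inv_mul_le_one_of_le₀ (ha n) hA.le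
  have h2 := smul_mem_traceSet (A : ℂ) h1
  rw [hAn] at h2
  convert h2 using 1
  ext n
  have : (A : ℂ) ≠ 0 := by rw [Complex.ofReal_ne_zero]; exact hA.ne'
  simp [this]

end uniform

/-! ### Boundary behaviour and the little Bloch space -/

/-- Otherwise a subsequence converges inside the disk, and data alternating between 1 and 0 along it
contradict continuity. -/
theorem tendsto_norm_of_interpolation {z : ℕ → ℂ} (hz : ∀ n, z n ∈ ball (0 : ℂ) 1)
    (h : ∀ a : ℕ → ℂ, (∀ n, ‖a n‖ ≤ 1) → ∃ C, a ∈ traceSet z C) :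
    Tendsto (fun n => ‖z n‖) atTop (𝓝[<] 1) := by
  have hz' (n : ℕ) : ‖z n‖ < 1 := by simpa using hz n
  refine tendsto_nhdsWithin_iff.2 ⟨tendsto_order.2 ⟨fun ρ hρ => ?_, fun ρ hρ => ?_⟩,
    Eventually.of_forall hz'⟩
  swap
  · exact Eventually.of_forall fun n => (hz' n).trans hρ
  by_contra hne
  have hfreq : ∃ᶠ n in atTop, z n ∈ closedBall (0 : ℂ) ρ := fun hev =>
    hne (hev.mono fun n hn => by simpa using hn)
  obtain ⟨w, hw, φ, hφ, hlim⟩ := (isCompact_closedBall (0 : ℂ) ρ).tendsto_subseq' hfreq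
  have hwb : w ∈ ball (0 : ℂ) 1 := closedBall_subset_ball hρ hw
  classical
  obtain ⟨C, g, hg, hga⟩ := h (fun n => if ∃ k, n = φ (2 * k) then 1 else 0) fun n => by
    split_ifs <;> simp
  have hgc : ContinuousAt (fun u : ℂ => ((1 - ‖u‖ ^ 2 : ℝ) : ℂ) * g u) w := by
    refine ContinuousAt.mul (by fun_prop) ?_
    exact hg.1.continuousOn.continuousAt (isOpen_ball.mem_nhds hwb)
  have hT : Tendsto (fun k => weightedTrace z g (φ k)) atTop
      (𝓝 (((1 - ‖w‖ ^ 2 : ℝ) : ℂ) * g w)) := hgc.tendsto.comp hlim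
  rw [hga] at hT
  have h2 : Tendsto (fun k : ℕ => 2 * k) atTop atTop :=
    tendsto_atTop_mono (fun k => by rw [id]; omega) tendsto_id
  have h3 : Tendsto (fun k : ℕ => 2 * k + 1) atTop atTop :=
    tendsto_atTop_mono (fun k => by rw [id]; omega) tendsto_id
  have e1 := tendsto_nhds_unique (hT.comp h2) (tendsto_const_nhds (x := (1 : ℂ)) |>.congr
    fun k => by simp [hφ.injective.eq_iff])
  have e2 := tendsto_nhds_unique (hT.comp h3) (tendsto_const_nhds (x := (0 : ℂ)) |>.congr
    fun k => by
      have : ¬ ∃ j, 2 * k + 1 = 2 * j := by omega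
      simp only [Function.comp_apply, hφ.injective.eq_iff, this, if_false])
  rw [e1] at e2
  exact one_ne_zero e2

theorem tendsto_one_sub_norm_sq :
    Tendsto (fun u : ℂ => 1 - ‖u‖ ^ 2) (comap norm (𝓝[<] (1 : ℝ))) (𝓝 0) := by
  have h1 : Tendsto (fun u : ℂ => ‖u‖) (comap norm (𝓝[<] (1 : ℝ))) (𝓝 1) :=
    tendsto_comap.mono_right nhdsWithin_le_nhds
  simpa using tendsto_const_nhds (x := (1 : ℝ)) |>.sub (h1.pow 2)

theorem eventually_mem_ball : ∀ᶠ u : ℂ in comap norm (𝓝[<] (1 : ℝ)), u ∈ ball (0 : ℂ) 1 := by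
  filter_upwards [tendsto_comap.eventually (self_mem_nhdsWithin (a := (1 : ℝ)))] with u hu
  simpa using hu

/-- The growth analogue of the little Bloch condition. -/
def VanishesAtBoundary (g : ℂ → ℂ) : Prop :=
  Tendsto (fun u : ℂ => (1 - ‖u‖ ^ 2) * ‖g u‖) (comap norm (𝓝[<] (1 : ℝ))) (𝓝 0)

theorem vanishesAtBoundary_of_bounded {g : ℂ → ℂ} {B : ℝ} (hB : ∀ u ∈ ball (0 : ℂ) 1, ‖g u‖ ≤ B) :
    VanishesAtBoundary g := by
  refine squeeze_zero' (g := fun u : ℂ => (1 - ‖u‖ ^ 2) * B) ?_ ?_ ?_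
  · filter_upwards [eventually_mem_ball] with u hu
    exact mul_nonneg (one_sub_norm_sq_pos hu).le (norm_nonneg _)
  · filter_upwards [eventually_mem_ball] with u hu
    exact mul_le_mul_of_nonneg_left (hB u hu) (one_sub_norm_sq_pos hu).le
  · simpa using tendsto_one_sub_norm_sq.mul_const B

namespace VanishesAtBoundary

variable {g h : ℂ → ℂ}

theorem add (hg : VanishesAtBoundary g) (hh : VanishesAtBoundary h) :
    VanishesAtBoundary (fun u => g u + h u) := by
  have hs := Tendsto.add hg hh
  rw [add_zero] at hs
  refine squeeze_zero' ?_ ?_ hs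
  · filter_upwards [eventually_mem_ball] with u hu
    exact mul_nonneg (one_sub_norm_sq_pos hu).le (norm_nonneg _)
  · filter_upwards [eventually_mem_ball] with u hu
    rw [← mul_add]
    exact mul_le_mul_of_nonneg_left (norm_add_le _ _) (one_sub_norm_sq_pos hu).le

theorem smul (c : ℂ) (hg : VanishesAtBoundary g) : VanishesAtBoundary (fun u => c * g u) := by
  have hs := Tendsto.const_mul ‖c‖ hg
  rw [mul_zero] at hs
  refine hs.congr fun u => ?_
  rw [norm_mul]
  ring

theorem weightedTrace_mem_cZero (hg : VanishesAtBoundary g) {z : ℕ → ℂ}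
    (hz : ∀ n, z n ∈ ball (0 : ℂ) 1) (hzlim : Tendsto (fun n => ‖z n‖) atTop (𝓝[<] 1)) :
    weightedTrace z g ∈ cZero := by
  refine tendsto_zero_iff_norm_tendsto_zero.2 ?_
  refine (Tendsto.comp hg (tendsto_comap_iff.2 hzlim)).congr fun n => ?_
  rw [weightedTrace, norm_mul, Complex.norm_real,
    Real.norm_of_nonneg (one_sub_norm_sq_pos (hz n)).le]
  rfl

end VanishesAtBoundary

theorem exists_dilation_approx {z : ℕ → ℂ} (hz : ∀ n, z n ∈ ball (0 : ℂ) 1) {C : ℝ} {g : ℂ → ℂ}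
    (hg : HasBlochGrowth C g) (N : ℕ) {ε : ℝ} (hε : 0 < ε) :
    ∃ h, HasBlochGrowth C h ∧ VanishesAtBoundary h ∧
      ∀ n < N, ‖weightedTrace z h n - weightedTrace z g n‖ ≤ ε := by
  have hev (n : ℕ) : ∀ᶠ r : ℝ in 𝓝[<] 1,
      ‖weightedTrace z (fun w => g (r * w)) n - weightedTrace z g n‖ ≤ ε := by
    have hc : ContinuousAt g (((1 : ℝ) : ℂ) * z n) := by
      refine hg.1.continuousOn.continuousAt (isOpen_ball.mem_nhds ?_)
      simpa using hz n
    have h1 : Tendsto (fun r : ℝ => g ((r : ℂ) * z n)) (𝓝 1) (𝓝 (g (((1 : ℝ) : ℂ) * z n))) :=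
      hc.tendsto.comp (Continuous.tendsto
        (show Continuous fun r : ℝ => (r : ℂ) * z n by fun_prop) 1)
    have h2 := ((h1.const_mul ((1 - ‖z n‖ ^ 2 : ℝ) : ℂ)).sub_const (weightedTrace z g n)).norm
    refine (h2.mono_left nhdsWithin_le_nhds).eventually (ge_mem_nhds ?_)
    simpa [weightedTrace] using hε
  have hfin : ∀ᶠ r : ℝ in 𝓝[<] 1, ∀ n ∈ Set.Iio N,
      ‖weightedTrace z (fun w => g (r * w)) n - weightedTrace z g n‖ ≤ ε :=
    (eventually_all_finite (Set.finite_Iio N)).2 fun n _ => hev n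
  obtain ⟨r, hr, hr0, hr1⟩ := (hfin.and (Ioo_mem_nhdsLT (show (0 : ℝ) < 1 by norm_num))).exists
  refine ⟨_, hg.comp_mul hr0 hr1,
    vanishesAtBoundary_of_bounded (B := C / (1 - r ^ 2)) fun u hu => ?_, hr⟩
  refine hg.norm_le_of_norm_le hr1 ?_
  have hu' : ‖u‖ < 1 := by simpa using hu
  rw [norm_mul, Complex.norm_real, Real.norm_of_nonneg hr0.le]
  nlinarith [norm_nonneg u]

/-- Averaging dilations approximates a trace tending to zero by vanishing functions. -/
theorem exists_vanishing_approx {z : ℕ → ℂ} (hz : ∀ n, z n ∈ ball (0 : ℂ) 1)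
    (hzlim : Tendsto (fun n => ‖z n‖) atTop (𝓝[<] 1)) {C : ℝ} {g : ℂ → ℂ}
    (hg : HasBlochGrowth C g) (hga : weightedTrace z g ∈ cZero) {δ : ℝ} (hδ : 0 < δ) :
    ∃ h, HasBlochGrowth C h ∧ VanishesAtBoundary h ∧
      ∀ n, ‖weightedTrace z g n - weightedTrace z h n‖ ≤ δ := by
  set a := weightedTrace z g with ha
  set ε := δ / 2 with hε
  have hε0 : 0 < ε := by linarith
  have hC := hg.nonneg
  -- The next dilation is accurate for `n < N`, where `N` is so large that the previous sum and `(K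
  -- + 1) * a` are negligible beyond it. So the crude bound `C` is paid once, not `K` times, and
  -- dividing by `K` removes it.
  have step (K : ℕ) : ∃ h, HasBlochGrowth (K * C) h ∧ VanishesAtBoundary h ∧
      ∀ n, ‖weightedTrace z h n - K * a n‖ ≤ C + K * ε := by
    induction K with
    | zero =>
      refine ⟨fun _ => 0, ⟨by fun_prop, by simp⟩,
        vanishesAtBoundary_of_bounded (B := 0) (by simp), fun n => ?_⟩
      simpa [weightedTrace] using hC
    | succ K ih =>
      obtain ⟨h, hh, hv, hK⟩ := ih
      have l1 := (hv.weightedTrace_mem_cZero hz hzlim).norm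
      have l2 := (Tendsto.const_mul ((K + 1 : ℕ) : ℂ) hga).norm
      rw [norm_zero] at l1
      rw [mul_zero, norm_zero] at l2
      obtain ⟨N, hN⟩ := eventually_atTop.1 ((l1.eventually (ge_mem_nhds (half_pos hε0))).and
        (l2.eventually (ge_mem_nhds (half_pos hε0))))
      obtain ⟨g', hg', hv', happ⟩ := exists_dilation_approx hz hg N hε0
      refine ⟨fun w => h w + g' w, ?_, hv.add hv', fun n => ?_⟩
      · convert hh.add hg' using 1
        push_cast
        ring
      · rw [weightedTrace_add, Pi.add_apply]
        push_cast
        have hKε : 0 ≤ K * ε := by positivity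
        rcases lt_or_ge n N with hn | hn
        · have e : weightedTrace z h n + weightedTrace z g' n - (K + 1) * a n =
              (weightedTrace z h n - K * a n) + (weightedTrace z g' n - a n) := by ring
          rw [e]
          linarith [norm_add_le (weightedTrace z h n - K * a n) (weightedTrace z g' n - a n),
            hK n, happ n hn]
        · obtain ⟨b1, b2⟩ := hN n hn
          push_cast at b2
          have b3 := hg'.norm_weightedTrace_le (hz n)
          have t1 := norm_sub_le (weightedTrace z h n + weightedTrace z g' n) ((K + 1) * a n)
          have t2 := norm_add_le (weightedTrace z h n) (weightedTrace z g' n)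
          linarith
  obtain ⟨K, hK⟩ := exists_nat_gt (C / ε)
  have hK0 : (0 : ℝ) < K := (div_nonneg hC hε0.le).trans_lt hK
  rw [div_lt_iff₀ hε0] at hK
  obtain ⟨h, hh, hv, happ⟩ := step K
  have hKn : ‖(K : ℂ)⁻¹‖ = (K : ℝ)⁻¹ := by simp
  have hKc : (K : ℂ) ≠ 0 := by exact_mod_cast hK0.ne'
  refine ⟨_, ?_, hv.smul (K : ℂ)⁻¹, fun n => ?_⟩
  · have := hh.smul (K : ℂ)⁻¹
    rwa [hKn, inv_mul_cancel_left₀ hK0.ne'] at this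
  · rw [weightedTrace_smul, Pi.smul_apply, smul_eq_mul]
    have e : a n - (K : ℂ)⁻¹ * weightedTrace z h n =
        (K : ℂ)⁻¹ * (K * a n - weightedTrace z h n) := by
      rw [mul_sub, inv_mul_cancel_left₀ hKc]
    rw [e, norm_mul, hKn, norm_sub_rev, inv_mul_le_iff₀ hK0]
    have := happ n
    rw [hε] at this hK
    linarith

/-- Pointwise limits need not vanish at the boundary; the geometric majorant gives dominated
convergence there. -/
theorem exists_hasSum_vanishesAtBoundary {D q : ℝ} (hq0 : 0 ≤ q) (hq1 : q < 1) {h : ℕ → ℂ → ℂ}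
    (hh : ∀ k, HasBlochGrowth (D * q ^ k) (h k)) (hv : ∀ k, VanishesAtBoundary (h k)) :
    ∃ g C, HasBlochGrowth C g ∧ VanishesAtBoundary g ∧
      ∀ w ∈ ball (0 : ℂ) 1, HasSum (fun k => h k w) (g w) := by
  have hgeo := summable_geometric_of_lt_one hq0 hq1
  have hbd (ρ : ℝ) (hρ : ρ < 1) (k : ℕ) (w : ℂ) (hw : ‖w‖ ≤ ρ) :
      ‖h k w‖ ≤ D / (1 - ρ ^ 2) * q ^ k := by
    convert (hh k).norm_le_of_norm_le hρ hw using 1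
    ring
  have hsum (w : ℂ) (hw : w ∈ ball (0 : ℂ) 1) : Summable fun k => ‖h k w‖ :=
    Summable.of_nonneg_of_le (fun _ => norm_nonneg _)
      (fun k => hbd ‖w‖ (by simpa using hw) k w le_rfl) (hgeo.mul_left _)
  have hle (w : ℂ) (hw : w ∈ ball (0 : ℂ) 1) :
      (1 - ‖w‖ ^ 2) * ‖∑' k, h k w‖ ≤ ∑' k, (1 - ‖w‖ ^ 2) * ‖h k w‖ := by
    rw [tsum_mul_left]
    exact mul_le_mul_of_nonneg_left (norm_tsum_le_tsum_norm (hsum w hw))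
      (one_sub_norm_sq_pos hw).le
  refine ⟨fun w => ∑' k, h k w, ∑' k, D * q ^ k, ⟨?_, fun w hw => ?_⟩, ?_,
    fun w hw => (hsum w hw).of_norm.hasSum⟩
  · intro w hw
    have hw' : ‖w‖ < 1 := by simpa using hw
    obtain ⟨ρ, hwρ, hρ⟩ := exists_between hw'
    have hd : DifferentiableOn ℂ (fun w => ∑' k, h k w) (ball 0 ρ) :=
      Complex.differentiableOn_tsum_of_summable_norm (hgeo.mul_left (D / (1 - ρ ^ 2)))
        (fun k => (hh k).1.mono (ball_subset_ball hρ.le)) isOpen_ball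
        fun k u hu => hbd ρ hρ k u (by simpa using (mem_ball_zero_iff.1 hu).le)
    exact (hd.differentiableAt (isOpen_ball.mem_nhds (by simpa using hwρ))).differentiableWithinAt
  · exact (hle w hw).trans (Summable.tsum_le_tsum (fun k => (hh k).2 w hw)
      ((hsum w hw).mul_left _) (hgeo.mul_left D))
  · have key := tendsto_tsum_of_dominated_convergence (𝓕 := comap norm (𝓝[<] (1 : ℝ)))
      (f := fun (u : ℂ) k => (1 - ‖u‖ ^ 2) * ‖h k u‖) (g := fun _ => 0) (hgeo.mul_left D) hv (by
        filter_upwards [eventually_mem_ball] with u hu k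
        rw [Real.norm_of_nonneg (mul_nonneg (one_sub_norm_sq_pos hu).le (norm_nonneg _))]
        exact (hh k).2 u hu)
    rw [tsum_zero] at key
    refine squeeze_zero' ?_ ?_ key
    · filter_upwards [eventually_mem_ball] with u hu
      exact mul_nonneg (one_sub_norm_sq_pos hu).le (norm_nonneg _)
    · filter_upwards [eventually_mem_ball] with u hu
      exact hle u hu

theorem exists_vanishing_weightedTrace_eq {z : ℕ → ℂ} (hz : ∀ n, z n ∈ ball (0 : ℂ) 1) {C : ℝ}
    (h : ∀ a : ℕ → ℂ, (∀ n, ‖a n‖ ≤ 1) → a ∈ traceSet z C) {a : ℕ → ℂ} (ha : a ∈ cZero) :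
    ∃ g D, HasBlochGrowth D g ∧ VanishesAtBoundary g ∧ weightedTrace z g = a := by
  have hzlim := tendsto_norm_of_interpolation hz fun a ha => ⟨C, h a ha⟩
  obtain ⟨A, hA⟩ := (isBounded_range_of_tendsto a ha).exists_norm_le
  have hA' (n : ℕ) : ‖a n‖ ≤ max A 1 := (hA _ ⟨n, rfl⟩).trans (le_max_left _ _)
  have hA0 : 0 < max A 1 := lt_max_of_lt_right one_pos
  generalize max A 1 = A at hA' hA0
  -- Making the choice for every `r`, with default `0`, lets the residuals be defined by recursion
  -- before their bounds are proved.
  have step (k : ℕ) (r : ℕ → ℂ) : ∃ g, r ∈ cZero → (∀ n, ‖r n‖ ≤ A * (1 / 2) ^ k) →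
      HasBlochGrowth (A * C * (1 / 2) ^ k) g ∧ VanishesAtBoundary g ∧
        ∀ n, ‖r n - weightedTrace z g n‖ ≤ A * (1 / 2) ^ (k + 1) := by
    by_cases hr : r ∈ cZero ∧ ∀ n, ‖r n‖ ≤ A * (1 / 2) ^ k
    · obtain ⟨g, hg, rfl⟩ := mem_traceSet_of_norm_le (by positivity) h r hr.2
      obtain ⟨g', hg', hv, happ⟩ := exists_vanishing_approx hz hzlim hg hr.1
        (δ := A * (1 / 2) ^ (k + 1)) (by positivity)
      refine ⟨g', fun _ _ => ⟨?_, hv, happ⟩⟩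
      convert hg' using 1
      ring
    · exact ⟨0, fun h1 h2 => absurd ⟨h1, h2⟩ hr⟩
  choose F hF using step
  let r : ℕ → ℕ → ℂ := fun k => Nat.rec a (fun k s => s - weightedTrace z (F k s)) k
  have hrs (k : ℕ) : r (k + 1) = r k - weightedTrace z (F k (r k)) := rfl
  have hr (k : ℕ) : r k ∈ cZero ∧ ∀ n, ‖r k n‖ ≤ A * (1 / 2) ^ k := by
    induction k with
    | zero => exact ⟨ha, by simpa [r] using hA'⟩
    | succ k ih =>
      obtain ⟨-, hv, happ⟩ := hF k (r k) ih.1 ih.2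
      refine ⟨?_, happ⟩
      -- Residuals stay null because vanishing functions have null traces when `|z n| → 1`.
      have := Tendsto.sub ih.1 (hv.weightedTrace_mem_cZero hz hzlim)
      rwa [sub_zero] at this
  have hG (k : ℕ) := hF k (r k) (hr k).1 (hr k).2
  obtain ⟨g, D, hg, hv, hs⟩ := exists_hasSum_vanishesAtBoundary (by norm_num) (by norm_num)
    (fun k => (hG k).1) (fun k => (hG k).2.1)
  refine ⟨g, D, hg, hv, funext fun n => ?_⟩
  have h1 := ((hs _ (hz n)).mul_left ((1 - ‖z n‖ ^ 2 : ℝ) : ℂ)).tendsto_sum_nat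
  have h2 (K : ℕ) : ∑ k ∈ Finset.range K, ((1 - ‖z n‖ ^ 2 : ℝ) : ℂ) * F k (r k) (z n) =
      a n - r K n := by
    induction K with
    | zero => simp [r]
    | succ K ih =>
      rw [Finset.sum_range_succ, ih, hrs, Pi.sub_apply, weightedTrace]
      ring
  have h3 : Tendsto (fun K => r K n) atTop (𝓝 0) := by
    refine squeeze_zero_norm (fun K => (hr K).2 n) ?_
    simpa using (tendsto_pow_atTop_nhds_zero_of_lt_one (r := (1 / 2 : ℝ)) (by norm_num)
      (by norm_num)).const_mul A
  have h4 := tendsto_const_nhds (x := a n) |>.sub h3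
  rw [sub_zero] at h4
  exact tendsto_nhds_unique h1 (h4.congr fun K => (h2 K).symm)

theorem cZero_subset_ellInfty : cZero ⊆ ellInfty := by
  intro a ha
  obtain ⟨A, hA⟩ := (isBounded_range_of_tendsto a ha).exists_norm_le
  refine memℓp_infty ⟨A, ?_⟩
  rintro _ ⟨n, rfl⟩
  exact hA _ ⟨n, rfl⟩

theorem mainTheorem4 (z : ℕ → ℂ) (hz : ∀ n, z n ∈ ball (0 : ℂ) 1) :
    List.TFAE [
      Interpolates blochSpace cZero z,
      Interpolates littleBlochSpace cZero z,
      Interpolates blochSpace ellInfty z,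
      Interpolates blochSpace ellInftyIdempotents z] := by
  have uniform_of_cZero (h : Interpolates blochSpace cZero z) :
      ∃ C, ∀ a : ℕ → ℂ, (∀ n, ‖a n‖ ≤ 1) → a ∈ traceSet z C := by
    obtain ⟨C, hC⟩ := exists_forall_cZero_mem_traceSet hz
      ((interpolates_blochSpace_iff hz _).1 h)
    exact ⟨C, forall_mem_traceSet_of_cZero hz hC⟩
  have uniform_of_idempotents (h : Interpolates blochSpace ellInftyIdempotents z) :
      ∃ C, ∀ a : ℕ → ℂ, (∀ n, ‖a n‖ ≤ 1) → a ∈ traceSet z C := by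
    obtain ⟨C, hC⟩ := exists_forall_boolSeq_mem_traceSet hz
      ((interpolates_blochSpace_iff hz _).1 h)
    exact exists_forall_mem_traceSet_of_boolSeq hz hC
  tfae_have 3 → 1 := fun h a ha => h a (cZero_subset_ellInfty ha)
  tfae_have 3 → 4 := fun h a ha => h a ha.1
  tfae_have 2 → 1 := fun h a ha => by
    obtain ⟨f, hf, hfa⟩ := h a ha
    exact ⟨f, hf.1, hfa⟩
  tfae_have 1 → 2 := fun h a ha => by
    obtain ⟨C, hC⟩ := uniform_of_cZero h
    obtain ⟨g, D, hg, hv, rfl⟩ := exists_vanishing_weightedTrace_eq hz hC ha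
    obtain ⟨f, hf, hfg⟩ := hg.exists_primitive
    refine ⟨f, ⟨hf, Tendsto.congr' ?_ hv⟩, fun n => by rw [hfg _ (hz n), weightedTrace]⟩
    filter_upwards [eventually_mem_ball] with u hu
    rw [hfg u hu]
  tfae_have 4 → 3 := fun h => by
    obtain ⟨C, hC⟩ := uniform_of_idempotents h
    refine (interpolates_blochSpace_iff hz _).2 fun a ha => ?_
    obtain ⟨A, hA⟩ := memℓp_infty_iff.1 ha
    refine ⟨_, mem_traceSet_of_norm_le (A := max A 1) (lt_max_of_lt_right one_pos) hC a
      fun n => (hA ⟨n, rfl⟩).trans (le_max_left _ _)⟩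
  tfae_have 1 → 4 := fun h => by
    obtain ⟨C, hC⟩ := uniform_of_cZero h
    refine (interpolates_blochSpace_iff hz _).2 fun a ha => ?_
    obtain ⟨A, hA⟩ := memℓp_infty_iff.1 ha.1
    exact ⟨_, mem_traceSet_of_norm_le (A := max A 1) (lt_max_of_lt_right one_pos) hC a
      fun n => (hA ⟨n, rfl⟩).trans (le_max_left _ _)⟩
  tfae_finish
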